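/- Let $\delta\in(0,1)$, $k=\lceil 360\log(2/\delta)\rceil$ and let $N\ge k$. Let $X_1,\dots,X_N$ be i.i.d. random vectors in $\mathbb{R}^d$ with $\mathbb{E}\|X_1\|^2<\infty$, mean $\mu$ and covariance matrix $\Sigma$, and let $\lambda_{\max}$ be the largest eigenvalue of $\Sigma$. Let $B_1,\dots,B_k$ be a partition of $\{1,\dots,N\}$ into blocks of size $|B_j|\ge\lfloor N/k\rfloor$ (so that $|B_j|=N/k$ for all $j$ if $k$ divides $N$), and let $Z_j=\frac{1}{|B_j|}\sum_{i\in B_j}X_i$ be the block means. Set $$r=\max\left(400\sqrt{\frac{\operatorname{Tr}(\Sigma)}{N}},\ 240\sqrt{\frac{\lambda_{\max}\log(2/\delta)}{N}}\right).$$ Then, with probability at least $1-\delta$, for every $a\in\mathbb{R}^d$ with $a\ne\mu$ and $\|a-\mu\|\ge r$ one has $\|Z_j-a\|>\|Z_j-\mu\|$ for more than $k/2$ of the indices $j\in\{1,\dots,k\}$. (The condition $a\ne\mu$ is automatic unless $\Sigma=0$.) -/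

import Mathlib

open MeasureTheory ProbabilityTheory

/-- The sample mean `(1/|B|) ∑ i ∈ B, X i ω` of the random vectors `X i`, `i ∈ B`. -/
noncomputable def blockMean {Ω : Type*} {d N : ℕ} (X : Fin N → Ω → EuclideanSpace ℝ (Fin d))
    (B : Finset (Fin N)) (ω : Ω) : EuclideanSpace ℝ (Fin d) :=
  (B.card : ℝ)⁻¹ • ∑ i ∈ B, X i ω

/-- The covariance matrix of a random vector `Y`, with entries `Cov(Y a, Y b)`. -/
noncomputable def covarianceMatrix {Ω : Type*} [MeasurableSpace Ω] {d : ℕ}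
    (Y : Ω → EuclideanSpace ℝ (Fin d)) (P : Measure Ω) : Matrix (Fin d) (Fin d) ℝ :=
  Matrix.of fun a b => cov[fun ω => Y ω a, fun ω => Y ω b; P]

/-- The largest eigenvalue of a real matrix whose eigenvalues are all real, such as a
covariance matrix. -/
noncomputable def lambdaMax {d : ℕ} (S : Matrix (Fin d) (Fin d) ℝ) : ℝ :=
  sSup {t : ℝ | Module.End.HasEigenvalue (Matrix.toLin' S) t}

/-- `B` splits the index set `Fin N` into `k` pairwise disjoint blocks,
each with at least `⌊N / k⌋` elements. If `k` divides `N`, all blocks have size `N / k`. -/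
structure IsBlockPartition {N k : ℕ} (B : Fin k → Finset (Fin N)) : Prop where
  disjoint : ∀ i j : Fin k, i ≠ j → Disjoint (B i) (B j)
  cover : ∀ n : Fin N, ∃ j : Fin k, n ∈ B j
  card_ge : ∀ j : Fin k, N / k ≤ (B j).card

/-- The radius `max (400 √(Tr S / N)) (240 √(λ_max(S) log(2/δ) / N))`. -/
noncomputable def radius {d : ℕ} (S : Matrix (Fin d) (Fin d) ℝ) (N : ℕ) (δ : ℝ) : ℝ :=
  max (400 * √(S.trace / N)) (240 * √(lambdaMax S * Real.log (2 / δ) / N))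

/-!
A block `j` fails to prefer `μ` to `a` only if the projection of `Z j - μ` on `a - μ` is at least
`‖a - μ‖ ^ 2 / 2`. After rescaling the direction to a vector `u` of length `ρ = √(k / 50)`, it
suffices that, outside an event of probability `δ`, fewer than `k / 2` of the projections
`⟪Z j - μ, u⟫` reach the level `t = ρ r / 2`, for all `u` of length `ρ` at once.

The uniformity in `u` comes from a PAC-Bayes argument with Gaussian smoothing, so that no supremum
over directions ever has to be controlled. Let `γ` be the standard Gaussian measure, let `q x`
bound the probability that a projection `⟪Z j - μ, x⟫` reaches `t`, and put
`F x = #{j | t ≤ ⟪Z j - μ, x⟫} - 2 k q x`.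
* For fixed `x`, independence of the blocks gives `E exp (F x) ≤ 1`, so by Fubini and Markov
  `∫ exp F ∂γ ≤ 1 / δ` outside an event of probability at most `δ`.
* On that single event, the Cameron–Martin formula and Jensen's inequality bound the average of
  `F` over the translate of `γ` by any `u` by `log (1 / δ) + ‖u‖ ^ 2 / 2`
  (`integral_add_stdGaussian_le`).
* If `t ≤ ⟪w, u⟫` then `t ≤ ⟪w, u + x⟫` for at least half of the Gaussian `x`, by symmetry, so
  smoothing loses a factor of at most two in the count (`exceeds_div_two_le_integral`).

Together these give `exists_event_sum_exceeds_le`. Chebyshev's inequality provides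
`q x = (2 k / N) xᵀ S x / t ^ 2`, whose average around `u` is `(2 k / N) (uᵀ S u + Tr S) / t ^ 2`;
the two terms of the radius control `uᵀ S u ≤ λ_max ρ ^ 2` and `Tr S` respectively
(`pacBayes_bound_lt`). If the radius is zero then `Tr S = 0` and every `Z j` equals `μ` almost
surely.
-/

/-! ### The standard Gaussian measure -/

section Gaussian

variable {E : Type*} [NormedAddCommGroup E] [InnerProductSpace ℝ E] [FiniteDimensional ℝ E]
  [MeasurableSpace E] [BorelSpace E]

theorem integrable_exp_neg_half_norm_sq : Integrable fun x : E => Real.exp (-‖x‖ ^ 2 / 2) := by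
  have h := (GaussianFourier.integrable_cexp_neg_mul_sq_norm_add (V := E) (b := 1 / 2)
    (by norm_num) 0 0).norm
  refine h.congr (.of_forall fun x => ?_)
  simp only [Complex.norm_exp]
  congr 1
  simp [← Complex.ofReal_pow]
  ring

/-- The density of the standard Gaussian measure, identified through its characteristic function.
-/
theorem stdGaussian_eq_withDensity :
    stdGaussian E = volume.withDensity fun x => ENNReal.ofReal
      ((2 * Real.pi) ^ (-(Module.finrank ℝ E / 2 : ℝ)) * Real.exp (-‖x‖ ^ 2 / 2)) := by
  have hint : Integrable fun x : E =>
      (2 * Real.pi) ^ (-(Module.finrank ℝ E / 2 : ℝ)) * Real.exp (-‖x‖ ^ 2 / 2) :=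
    integrable_exp_neg_half_norm_sq.const_mul _
  have := isFiniteMeasure_withDensity_ofReal hint.2
  refine Measure.ext_of_charFun ?_
  ext t
  rw [charFun_stdGaussian, charFun_apply, integral_withDensity_eq_integral_toReal_smul
    (by fun_prop) (.of_forall fun _ => ENNReal.ofReal_lt_top)]
  have h := GaussianFourier.integral_cexp_neg_mul_sq_norm_add (V := E) (b := 1 / 2)
    (by norm_num) Complex.I t
  have hpi : (0 : ℝ) < 2 * Real.pi := by positivity
  calc _ = (((2 * Real.pi) ^ (-(Module.finrank ℝ E / 2 : ℝ)) : ℝ) : ℂ) *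
        ((2 * Real.pi) ^ (Module.finrank ℝ E / 2 : ℝ) : ℝ) * Complex.exp (-‖t‖ ^ 2 / 2) := by
        rw [← Complex.ofReal_mul, ← Real.rpow_add hpi]
        simp
    _ = _ := by
      rw [mul_assoc]
      have h2 : (Real.pi / (1 / 2 : ℂ)) = ((2 * Real.pi : ℝ) : ℂ) := by push_cast; ring
      have h3 : Complex.I ^ 2 * (‖t‖ : ℂ) ^ 2 / (4 * (1 / 2)) = -‖t‖ ^ 2 / 2 := by
        rw [Complex.I_sq]; ring
      rw [h2, h3] at h
      have h4 : ((Module.finrank ℝ E / 2 : ℝ) : ℂ) = Module.finrank ℝ E / 2 := by push_cast; rfl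
      rw [Complex.ofReal_cpow hpi.le (Module.finrank ℝ E / 2), h4, ← h, ← integral_const_mul]
      refine integral_congr_ae (.of_forall fun x => ?_)
      simp only
      rw [ENNReal.toReal_ofReal (by positivity), Complex.real_smul, Complex.ofReal_mul,
        mul_assoc, Complex.ofReal_exp, ← Complex.exp_add, real_inner_comm]
      congr 2
      push_cast
      ring

/-- The Cameron–Martin formula for the standard Gaussian measure. -/
theorem lintegral_stdGaussian_eq_lintegral_add {f : E → ENNReal} (hf : Measurable f) (u : E) :
    ∫⁻ x, f x ∂stdGaussian E =
      ∫⁻ x, f (x + u) * ENNReal.ofReal (Real.exp (-inner ℝ x u - ‖u‖ ^ 2 / 2))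
        ∂stdGaussian E := by
  rw [stdGaussian_eq_withDensity, lintegral_withDensity_eq_lintegral_mul _ (by fun_prop) hf,
    lintegral_withDensity_eq_lintegral_mul _ (by fun_prop) (by fun_prop),
    ← lintegral_add_right_eq_self _ u]
  refine lintegral_congr fun x => ?_
  simp only [Pi.mul_apply]
  rw [mul_comm (f (x + u)), ← mul_assoc, ← ENNReal.ofReal_mul (by positivity), mul_assoc,
    ← Real.exp_add, norm_add_sq_real]
  congr 5
  ring

theorem integrable_inner_stdGaussian (u : E) :
    Integrable (fun x => inner ℝ x u) (stdGaussian E) := by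
  simpa only [id, real_inner_comm] using
    IsGaussian.integrable_id (μ := stdGaussian E) |>.const_inner u

theorem integral_inner_stdGaussian (u : E) : ∫ x, inner ℝ x u ∂stdGaussian E = 0 := by
  have := integral_inner (𝕜 := ℝ) (IsGaussian.integrable_id (μ := stdGaussian E)) u
  simpa [real_inner_comm] using this

/-- The Donsker–Varadhan inequality between the standard Gaussian measure and its translate
by `u`, whose relative entropy is `‖u‖ ^ 2 / 2`. -/
theorem integral_add_stdGaussian_le {F : E → ℝ} (hF : Measurable F) {K : ℝ} (hK : 0 < K)
    (hFK : ∫⁻ x, ENNReal.ofReal (Real.exp (F x)) ∂stdGaussian E ≤ ENNReal.ofReal K) (u : E)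
    (hint : Integrable (fun x => F (x + u)) (stdGaussian E)) :
    ∫ x, F (x + u) ∂stdGaussian E ≤ Real.log K + ‖u‖ ^ 2 / 2 := by
  set G : E → ℝ := fun x => F (x + u) + (-inner ℝ x u - ‖u‖ ^ 2 / 2) with hG
  have hGm : Measurable G := by fun_prop
  have hlin : ∫⁻ x, ENNReal.ofReal (Real.exp (G x)) ∂stdGaussian E ≤ ENNReal.ofReal K := by
    rw [lintegral_stdGaussian_eq_lintegral_add (by fun_prop) u] at hFK
    refine le_trans (lintegral_mono fun x => ?_) hFK
    rw [← ENNReal.ofReal_mul (by positivity), ← Real.exp_add]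
  have hexp : Integrable (fun x => Real.exp (G x)) (stdGaussian E) := by
    refine ⟨by fun_prop, ?_⟩
    rw [hasFiniteIntegral_iff_ofReal (.of_forall fun x => (Real.exp_pos _).le)]
    exact hlin.trans_lt ENNReal.ofReal_lt_top
  have hle : ∫ x, Real.exp (G x) ∂stdGaussian E ≤ K := by
    rw [integral_eq_lintegral_of_nonneg_ae (.of_forall fun x => (Real.exp_pos _).le) (by fun_prop)]
    exact ENNReal.toReal_le_of_le_ofReal hK.le hlin
  have hlinint : Integrable (fun x => -inner ℝ x u - ‖u‖ ^ 2 / 2) (stdGaussian E) :=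
    (integrable_inner_stdGaussian u).neg.sub (integrable_const _)
  have hGi : Integrable G (stdGaussian E) := hint.add hlinint
  have hGval : ∫ x, G x ∂stdGaussian E = ∫ x, F (x + u) ∂stdGaussian E - ‖u‖ ^ 2 / 2 := by
    rw [hG, integral_add hint hlinint, integral_sub (f := fun x => -inner ℝ x u)
      (integrable_inner_stdGaussian u).neg (integrable_const _), integral_neg, integral_inner_stdGaussian]
    simp
    ring
  -- The tangent line of `exp` at `log K` replaces Jensen's inequality.
  have htan : ∫ x, K * (1 + (G x - Real.log K)) ∂stdGaussian E ≤
      ∫ x, Real.exp (G x) ∂stdGaussian E := by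
    refine integral_mono (((integrable_const 1).add (hGi.sub (integrable_const _))).const_mul K)
      hexp fun x => ?_
    have h := mul_le_mul_of_nonneg_left (Real.add_one_le_exp (G x - Real.log K)) hK.le
    rw [Real.exp_sub, Real.exp_log hK, mul_div_cancel₀ _ hK.ne'] at h
    linarith
  rw [integral_const_mul, integral_add (g := fun x => G x - Real.log K) (integrable_const _)
    (hGi.sub (integrable_const _)),
    integral_sub hGi (integrable_const _)] at htan
  simp only [integral_const, probReal_univ, smul_eq_mul, one_mul] at htan
  have := le_of_mul_le_mul_left (htan.trans (hle.trans_eq (mul_one K).symm)) hK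
  linarith

theorem half_le_stdGaussian_real_inner_nonneg (v : E) :
    1 / 2 ≤ (stdGaussian E).real {x | 0 ≤ inner ℝ v x} := by
  have hm : MeasurableSet {x : E | 0 ≤ inner ℝ v x} := measurableSet_le (by fun_prop) (by fun_prop)
  have hsymm : (stdGaussian E).real {x | inner ℝ v x ≤ 0} =
      (stdGaussian E).real {x | 0 ≤ inner ℝ v x} := by
    have h := stdGaussian_map (E := E) (LinearIsometryEquiv.neg ℝ)
    conv_lhs => rw [← h]
    rw [map_measureReal_apply (LinearIsometryEquiv.continuous _).measurable
      (measurableSet_le (by fun_prop) (by fun_prop))]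
    congr 1
    ext x
    simp
  have hcov : (1 : ℝ) ≤ (stdGaussian E).real {x | inner ℝ v x ≤ 0} +
      (stdGaussian E).real {x | 0 ≤ inner ℝ v x} := by
    rw [← probReal_univ (μ := stdGaussian E)]
    refine le_trans (measureReal_mono fun x _ => ?_) (measureReal_union_le _ _)
    exact le_total (inner ℝ v x) 0
  linarith

end Gaussian

/-! ### Quadratic forms under the Gaussian measure -/

section QuadraticForm

variable {d : ℕ}

/-- The quadratic form `xᵀ S x` of a square matrix `S`. -/
def quadForm (S : Matrix (Fin d) (Fin d) ℝ) (x : EuclideanSpace ℝ (Fin d)) : ℝ :=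
  ∑ a, ∑ b, x a * S a b * x b

@[fun_prop]
theorem measurable_quadForm (S : Matrix (Fin d) (Fin d) ℝ) : Measurable (quadForm S) := by
  unfold quadForm
  fun_prop

theorem memLp_coord_stdGaussian (i : Fin d) :
    MemLp (fun x : EuclideanSpace ℝ (Fin d) => x i) 2 (stdGaussian (EuclideanSpace ℝ (Fin d))) :=
  (EuclideanSpace.proj (𝕜 := ℝ) i).comp_memLp' (IsGaussian.memLp_two_id)

theorem integral_coord_stdGaussian (i : Fin d) :
    ∫ x, x i ∂stdGaussian (EuclideanSpace ℝ (Fin d)) = 0 :=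
  integral_strongDual_stdGaussian (EuclideanSpace.proj (𝕜 := ℝ) i)

theorem integral_coord_mul_coord_stdGaussian (i j : Fin d) :
    ∫ x, x i * x j ∂stdGaussian (EuclideanSpace ℝ (Fin d)) =
      (1 : Matrix (Fin d) (Fin d) ℝ) i j := by
  have h := covariance_eval_multivariateGaussian (μ := (0 : EuclideanSpace ℝ (Fin d)))
    (S := 1) Matrix.PosSemidef.one i j
  rw [multivariateGaussian_zero_one,
    covariance_eq_sub (memLp_coord_stdGaussian i) (memLp_coord_stdGaussian j),
    integral_coord_stdGaussian] at h
  simpa using h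

/-- The average of a quadratic form over a translate of the standard Gaussian measure. -/
theorem integrable_and_integral_quadForm_add_stdGaussian (S : Matrix (Fin d) (Fin d) ℝ)
    (u : EuclideanSpace ℝ (Fin d)) :
    Integrable (fun x => quadForm S (x + u)) (stdGaussian (EuclideanSpace ℝ (Fin d))) ∧
      ∫ x, quadForm S (x + u) ∂stdGaussian (EuclideanSpace ℝ (Fin d)) =
        quadForm S u + S.trace := by
  have hi (a : Fin d) := (memLp_coord_stdGaussian a).integrable (by norm_num)
  have hm (a b : Fin d) : Integrable (fun x : EuclideanSpace ℝ (Fin d) => x a * x b)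
      (stdGaussian (EuclideanSpace ℝ (Fin d))) :=
    (memLp_coord_stdGaussian a).integrable_mul (memLp_coord_stdGaussian b)
  have h (a b : Fin d) :
      Integrable (fun x : EuclideanSpace ℝ (Fin d) => (x + u) a * S a b * (x + u) b)
          (stdGaussian (EuclideanSpace ℝ (Fin d))) ∧
        ∫ x, (x + u) a * S a b * (x + u) b ∂stdGaussian (EuclideanSpace ℝ (Fin d)) =
          u a * S a b * u b + S a b * (1 : Matrix (Fin d) (Fin d) ℝ) a b := by
    have heq : (fun x : EuclideanSpace ℝ (Fin d) => (x + u) a * S a b * (x + u) b) = fun x =>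
        S a b * (x a * x b) + S a b * u b * x a + S a b * u a * x b + u a * S a b * u b := by
      ext x
      simp only [PiLp.add_apply]
      ring
    have h1 := (hm a b).const_mul (S a b)
    have h2 := (hi a).const_mul (S a b * u b)
    have h3 := (hi b).const_mul (S a b * u a)
    have h12 : Integrable (fun x : EuclideanSpace ℝ (Fin d) =>
      S a b * (x a * x b) + S a b * u b * x a) (stdGaussian (EuclideanSpace ℝ (Fin d))) := h1.add h2
    have h123 : Integrable (fun x : EuclideanSpace ℝ (Fin d) =>
        S a b * (x a * x b) + S a b * u b * x a + S a b * u a * x b)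
      (stdGaussian (EuclideanSpace ℝ (Fin d))) := h12.add h3
    refine ⟨heq ▸ h123.add (integrable_const _), ?_⟩
    rw [heq, integral_add h123 (integrable_const _), integral_add h12 h3,
      integral_add h1 h2, integral_const_mul, integral_const_mul, integral_const_mul,
      integral_coord_stdGaussian, integral_coord_stdGaussian, integral_coord_mul_coord_stdGaussian]
    simp
    ring
  unfold quadForm
  refine ⟨integrable_finsetSum _ fun a _ => integrable_finsetSum _ fun b _ => (h a b).1, ?_⟩
  rw [integral_finsetSum _ fun a _ => integrable_finsetSum _ fun b _ => (h a b).1]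
  simp_rw [integral_finsetSum _ fun b _ => (h _ b).1, (h _ _).2, Finset.sum_add_distrib]
  simp [Matrix.one_apply, Matrix.trace]

end QuadraticForm

/-! ### Covariance matrices -/

section Covariance

variable {Ω : Type*} [MeasurableSpace Ω] {P : Measure Ω} {d : ℕ}

theorem MeasureTheory.MemLp.euclidean_coord {Y : Ω → EuclideanSpace ℝ (Fin d)} (hY : MemLp Y 2 P)
    (a : Fin d) : MemLp (fun ω => Y ω a) 2 P :=
  (EuclideanSpace.proj (𝕜 := ℝ) a).comp_memLp' hY

theorem variance_inner_eq_quadForm [IsProbabilityMeasure P] {Y : Ω → EuclideanSpace ℝ (Fin d)}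
    (hY : MemLp Y 2 P) (x : EuclideanSpace ℝ (Fin d)) :
    Var[fun ω => inner ℝ (Y ω) x; P] = quadForm (covarianceMatrix Y P) x := by
  have h : (fun ω => inner ℝ (Y ω) x) = ∑ a, fun ω => x a * Y ω a := by
    ext ω
    simp [PiLp.inner_apply]
  rw [h, variance_sum fun a => (hY.euclidean_coord a).const_mul (x a)]
  simp only [quadForm, covarianceMatrix, Matrix.of_apply, covariance_const_mul_left,
    covariance_const_mul_right]
  exact Finset.sum_congr rfl fun a _ => Finset.sum_congr rfl fun b _ => by ring

theorem quadForm_covarianceMatrix_nonneg [IsProbabilityMeasure P]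
    {Y : Ω → EuclideanSpace ℝ (Fin d)} (hY : MemLp Y 2 P) (x : EuclideanSpace ℝ (Fin d)) :
    0 ≤ quadForm (covarianceMatrix Y P) x := by
  rw [← variance_inner_eq_quadForm hY]
  exact variance_nonneg _ _

theorem isHermitian_covarianceMatrix (Y : Ω → EuclideanSpace ℝ (Fin d)) :
    (covarianceMatrix Y P).IsHermitian :=
  Matrix.IsHermitian.ext fun _ _ => covariance_comm _ _

theorem covarianceMatrix_diag {Y : Ω → EuclideanSpace ℝ (Fin d)} (hY : MemLp Y 2 P)
    (a : Fin d) : covarianceMatrix Y P a a = Var[fun ω => Y ω a; P] :=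
  covariance_self (hY.euclidean_coord a).aemeasurable

theorem trace_covarianceMatrix_nonneg {Y : Ω → EuclideanSpace ℝ (Fin d)} (hY : MemLp Y 2 P) :
    0 ≤ (covarianceMatrix Y P).trace := by
  refine Finset.sum_nonneg fun a _ => ?_
  rw [Matrix.diag_apply, covarianceMatrix_diag hY]
  exact variance_nonneg _ _

/-- A random vector whose covariance matrix has trace zero is almost surely constant. -/
theorem ae_eq_integral_of_trace_covarianceMatrix_eq_zero [IsProbabilityMeasure P]
    {Y : Ω → EuclideanSpace ℝ (Fin d)} (hY : MemLp Y 2 P) (h : (covarianceMatrix Y P).trace = 0) :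
    ∀ᵐ ω ∂P, Y ω = ∫ ω', Y ω' ∂P := by
  have hzero (a : Fin d) : Var[fun ω => Y ω a; P] = 0 := by
    rw [Matrix.trace, Finset.sum_eq_zero_iff_of_nonneg] at h
    · exact (covarianceMatrix_diag hY a).symm.trans (h a (Finset.mem_univ a))
    · intro b _
      rw [Matrix.diag_apply, covarianceMatrix_diag hY]
      exact variance_nonneg _ _
  have hcoord (a : Fin d) : ∀ᵐ ω ∂P, Y ω a = ∫ ω', Y ω' a ∂P := by
    have h0 : eVar[fun ω => Y ω a; P] = 0 := by
      rw [← (hY.euclidean_coord a).ofReal_variance_eq, hzero a, ENNReal.ofReal_zero]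
    exact (evariance_eq_zero_iff (hY.euclidean_coord a).aemeasurable).1 h0
  filter_upwards [ae_all_iff.2 hcoord] with ω hω
  ext a
  rw [hω a]
  exact (EuclideanSpace.proj (𝕜 := ℝ) a).integral_comp_comm (hY.integrable (by norm_num))

/-- The Rayleigh bound, which also shows that the supremum defining `lambdaMax` is not a junk
value: `lambdaMax S • 1 - S` has nonnegative eigenvalues. -/
theorem quadForm_le_lambdaMax {S : Matrix (Fin d) (Fin d) ℝ} (hS : S.IsHermitian)
    (x : EuclideanSpace ℝ (Fin d)) : quadForm S x ≤ lambdaMax S * ‖x‖ ^ 2 := by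
  have hT : (lambdaMax S • (1 : Matrix (Fin d) (Fin d) ℝ) - S).IsHermitian :=
    (Matrix.isHermitian_one.smul (star_trivial _)).sub hS
  have hpsd : (lambdaMax S • (1 : Matrix (Fin d) (Fin d) ℝ) - S).PosSemidef := by
    rw [hT.posSemidef_iff_eigenvalues_nonneg]
    intro i
    have hv := hT.mulVec_eigenvectorBasis i
    rw [Matrix.sub_mulVec, Matrix.smul_mulVec, Matrix.one_mulVec] at hv
    have hmem : lambdaMax S - hT.eigenvalues i ∈
        {t : ℝ | Module.End.HasEigenvalue (Matrix.toLin' S) t} := by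
      refine Module.End.hasEigenvalue_of_hasEigenvector
        (x := (hT.eigenvectorBasis i).ofLp) ⟨?_, ?_⟩
      · rw [Module.End.mem_eigenspace_iff, Matrix.toLin'_apply, sub_smul, ← hv]
        abel
      · intro h0
        exact hT.eigenvectorBasis.orthonormal.ne_zero i (by ext a; exact congrFun h0 a)
    have := le_csSup (Module.End.finite_hasEigenvalue (Matrix.toLin' S)).bddAbove hmem
    change _ ≤ lambdaMax S at this
    simpa using this
  have h := hpsd.dotProduct_mulVec_nonneg x.ofLp
  rw [Matrix.sub_mulVec, dotProduct_sub, Matrix.smul_mulVec, Matrix.one_mulVec] at h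
  have h1 : star x.ofLp ⬝ᵥ (lambdaMax S • x.ofLp) = lambdaMax S * ‖x‖ ^ 2 := by
    rw [EuclideanSpace.real_norm_sq_eq]
    simp [dotProduct, Finset.mul_sum]
    exact Finset.sum_congr rfl fun a _ => by ring
  have h2 : star x.ofLp ⬝ᵥ (S.mulVec x.ofLp) = quadForm S x := by
    simp [dotProduct, Matrix.mulVec, quadForm, Finset.mul_sum, mul_assoc]
  linarith

end Covariance

/-! ### Block means -/

section BlockMean

variable {Ω : Type*} [MeasurableSpace Ω] {P : Measure Ω} {d N k : ℕ}

/-- Functions of disjoint blocks of an independent family are independent. -/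
theorem ProbabilityTheory.iIndepFun.comp_finset_blocks {ι κ β γ : Type*} [DecidableEq ι]
    [DecidableEq κ] [MeasurableSpace β] [MeasurableSpace γ] {X : ι → Ω → β} (hX : iIndepFun X P)
    (hm : ∀ i, Measurable (X i)) {B : κ → Finset ι} (hB : ∀ i j, i ≠ j → Disjoint (B i) (B j))
    {g : ∀ j, (B j → β) → γ} (hg : ∀ j, Measurable (g j)) :
    iIndepFun (fun j ω => g j fun i : B j => X i ω) P := by
  have := hX.isProbabilityMeasure
  rw [iIndepFun_iff_measure_inter_preimage_eq_mul]
  intro T s hs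
  induction T using Finset.cons_induction with
  | empty => simp
  | cons j T hj ih =>
    have hdisj : Disjoint (B j) (T.biUnion B) := by
      rw [Finset.disjoint_biUnion_right]
      exact fun i hi => hB j i fun h => hj (h ▸ hi)
    have hind := hX.indepFun_finset (B j) (T.biUnion B) hdisj hm
    let r (l : T) (y : T.biUnion B → β) : B l → β := fun i =>
      y ⟨i, Finset.mem_biUnion.2 ⟨l, l.2, i.2⟩⟩
    have hr (l : T) : Measurable (r l) := by
      unfold r
      fun_prop
    have h := hind.measure_inter_preimage_eq_mul (g j ⁻¹' s j)
      (⋂ l : T, (fun y => g l (r l y)) ⁻¹' s l)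
      (hg j (hs j (Finset.mem_cons_self j T)))
      (MeasurableSet.iInter fun l => ((hg l).comp (hr l)) (hs l (Finset.mem_cons_of_mem l.2)))
    have hT : (fun (a : Ω) (i : T.biUnion B) => X i a) ⁻¹'
        (⋂ l : T, (fun y => g l (r l y)) ⁻¹' s l) =
        ⋂ l ∈ T, (fun ω => g l fun i : B l => X i ω) ⁻¹' s l := by
      ext ω
      simp [r]
    rw [hT] at h
    rw [Finset.prod_cons, ← ih fun i hi => hs i (Finset.mem_cons_of_mem hi)]
    rw [← Finset.set_biInter_coe, Finset.coe_cons, Set.biInter_insert]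
    exact h

theorem measurable_blockMean {X : Fin N → Ω → EuclideanSpace ℝ (Fin d)}
    (hX : ∀ i, Measurable (X i)) (B : Finset (Fin N)) : Measurable (blockMean X B) := by
  unfold blockMean
  fun_prop

theorem iIndepFun_blockMean {X : Fin N → Ω → EuclideanSpace ℝ (Fin d)} (hindep : iIndepFun X P)
    (hX : ∀ i, Measurable (X i)) {B : Fin k → Finset (Fin N)}
    (hB : ∀ i j, i ≠ j → Disjoint (B i) (B j)) : iIndepFun (fun j => blockMean X (B j)) P := by
  have h := hindep.comp_finset_blocks hX hB
    (g := fun j y => ((B j).card : ℝ)⁻¹ • ∑ i : B j, y i) (fun j => by fun_prop)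
  convert! h using 3 with j ω
  rw [blockMean, Finset.sum_coe_sort (B j) fun i => X i ω]

theorem memLp_blockMean {X : Fin N → Ω → EuclideanSpace ℝ (Fin d)} (hX : ∀ i, MemLp (X i) 2 P)
    (B : Finset (Fin N)) : MemLp (blockMean X B) 2 P :=
  (memLp_finsetSum B fun i _ => hX i).const_smul ((B.card : ℝ)⁻¹)

theorem integral_blockMean [IsProbabilityMeasure P] {X : Fin N → Ω → EuclideanSpace ℝ (Fin d)}
    (hX : ∀ i, MemLp (X i) 2 P) {μ : EuclideanSpace ℝ (Fin d)} (hmean : ∀ i, ∫ ω, X i ω ∂P = μ)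
    {B : Finset (Fin N)} (hB : B.Nonempty) : ∫ ω, blockMean X B ω ∂P = μ := by
  simp only [blockMean]
  rw [integral_smul, integral_finsetSum _ fun i _ => (hX i).integrable (by norm_num)]
  have : (B.card : ℝ) ≠ 0 := by simpa using hB.ne_empty
  simp_rw [hmean, Finset.sum_const]
  rw [← Nat.cast_smul_eq_nsmul ℝ, smul_smul, inv_mul_cancel₀ this, one_smul]

theorem variance_inner_blockMean [IsProbabilityMeasure P]
    {X : Fin N → Ω → EuclideanSpace ℝ (Fin d)} (hindep : iIndepFun X P)
    (hX : ∀ i, MemLp (X i) 2 P) {S : Matrix (Fin d) (Fin d) ℝ}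
    (hcov : ∀ i, covarianceMatrix (X i) P = S) (B : Finset (Fin N))
    (x : EuclideanSpace ℝ (Fin d)) :
    Var[fun ω => inner ℝ (blockMean X B ω) x; P] = quadForm S x / B.card := by
  have h : (fun ω => inner ℝ (blockMean X B ω) x) =
      fun ω => (B.card : ℝ)⁻¹ * (∑ i ∈ B, fun ω => inner ℝ (X i ω) x) ω := by
    ext ω
    simp [blockMean, real_inner_smul_left, sum_inner]
  rw [h, variance_const_mul, IndepFun.variance_sum]
  · simp_rw [variance_inner_eq_quadForm (hX _), hcov, Finset.sum_const, nsmul_eq_mul]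
    rcases eq_or_ne (B.card : ℝ) 0 with h0 | h0
    · simp [h0]
    · field_simp
  · exact fun i _ => (hX i).inner_const x
  · intro i _ j _ hij
    exact (hindep.indepFun hij).comp (φ := fun y => inner ℝ y x) (ψ := fun y => inner ℝ y x)
      (by fun_prop) (by fun_prop)

/-- Chebyshev's inequality for the projection of a centred block mean. -/
theorem measure_le_inner_blockMean_sub_le [IsProbabilityMeasure P]
    {X : Fin N → Ω → EuclideanSpace ℝ (Fin d)} (hindep : iIndepFun X P)
    (hX : ∀ i, MemLp (X i) 2 P) {μ : EuclideanSpace ℝ (Fin d)} (hmean : ∀ i, ∫ ω, X i ω ∂P = μ)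
    {S : Matrix (Fin d) (Fin d) ℝ} (hcov : ∀ i, covarianceMatrix (X i) P = S)
    {B : Finset (Fin N)} (hB : B.Nonempty) (x : EuclideanSpace ℝ (Fin d)) {t : ℝ} (ht : 0 < t) :
    P {ω | t ≤ inner ℝ (blockMean X B ω - μ) x} ≤
      ENNReal.ofReal (quadForm S x / B.card / t ^ 2) := by
  have hZ := memLp_blockMean hX B
  rw [← variance_inner_blockMean hindep hX hcov B x]
  refine le_trans (measure_mono fun ω hω => ?_)
    (meas_ge_le_variance_div_sq (hZ.inner_const x) ht)
  have hmean' : ∫ ω, inner ℝ (blockMean X B ω) x ∂P = inner ℝ μ x := by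
    have := integral_inner (𝕜 := ℝ) (hZ.integrable (by norm_num)) x
    rw [integral_blockMean hX hmean hB] at this
    simpa [real_inner_comm] using this
  simp only [Set.mem_ofPred_eq, hmean', ← inner_sub_left] at hω ⊢
  exact hω.trans (le_abs_self _)

end BlockMean

/-! ### Counting large projections uniformly over directions -/

section Count

variable {Ω : Type*} [MeasurableSpace Ω] {P : Measure Ω} {d k : ℕ}

/-- The indicator that the projection of `w` on `x` is at least `t`. -/
noncomputable def exceeds (t : ℝ) (w x : EuclideanSpace ℝ (Fin d)) : ℝ :=
  open Classical in if t ≤ inner ℝ w x then 1 else 0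

@[fun_prop]
theorem Measurable.exceeds {α : Type*} [MeasurableSpace α] {f g : α → EuclideanSpace ℝ (Fin d)}
    (hf : Measurable f) (hg : Measurable g) (t : ℝ) :
    Measurable fun y => _root_.exceeds t (f y) (g y) :=
  Measurable.ite (measurableSet_le measurable_const (by fun_prop)) measurable_const
    measurable_const

theorem exceeds_nonneg (t : ℝ) (w x : EuclideanSpace ℝ (Fin d)) : 0 ≤ exceeds t w x := by
  unfold exceeds
  split_ifs <;> norm_num

theorem exceeds_le_one (t : ℝ) (w x : EuclideanSpace ℝ (Fin d)) : exceeds t w x ≤ 1 := by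
  unfold exceeds
  split_ifs <;> norm_num

theorem integrable_exceeds_add_stdGaussian (t : ℝ) (w u : EuclideanSpace ℝ (Fin d)) :
    Integrable (fun x => exceeds t w (x + u)) (stdGaussian (EuclideanSpace ℝ (Fin d))) := by
  refine Integrable.of_bound (Measurable.aestronglyMeasurable (by fun_prop)) 1 (.of_forall fun x => ?_)
  rw [Real.norm_of_nonneg (exceeds_nonneg _ _ _)]
  exact exceeds_le_one _ _ _

/-- Gaussian smoothing at worst halves the indicator, because `inner ℝ w x` is symmetric. -/
theorem exceeds_div_two_le_integral (t : ℝ) (w u : EuclideanSpace ℝ (Fin d)) :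
    exceeds t w u / 2 ≤ ∫ x, exceeds t w (x + u) ∂stdGaussian (EuclideanSpace ℝ (Fin d)) := by
  by_cases h : t ≤ inner ℝ w u
  · have hm : MeasurableSet {x : EuclideanSpace ℝ (Fin d) | 0 ≤ inner ℝ w x} :=
      measurableSet_le (by fun_prop) (by fun_prop)
    calc exceeds t w u / 2 = 1 / 2 := by simp [exceeds, h]
      _ ≤ _ := half_le_stdGaussian_real_inner_nonneg w
      _ = ∫ x, Set.indicator {x | 0 ≤ inner ℝ w x} 1 x
          ∂stdGaussian (EuclideanSpace ℝ (Fin d)) := (integral_indicator_one hm).symm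
      _ ≤ _ := by
        refine integral_mono ((integrable_const 1).indicator hm)
          (integrable_exceeds_add_stdGaussian t w u) fun x => ?_
        by_cases hx : 0 ≤ inner ℝ w x
        · have hx' : t ≤ inner ℝ w (x + u) := by
            rw [inner_add_right]
            linarith
          rw [exceeds, if_pos hx', Set.indicator_of_mem (by exact hx), Pi.one_apply]
        · rw [Set.indicator_of_notMem (by exact hx)]
          exact exceeds_nonneg _ _ _
  · have : exceeds t w u = 0 := by simp [exceeds, h]
    rw [this, zero_div]
    exact integral_nonneg fun x => exceeds_nonneg _ _ _

/-- The exponential moment of an indicator of probability at most `p`: since `e < 3`, it is at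
most `1 + 2 * p ≤ exp (2 * p)`. -/
theorem lintegral_exp_exceeds_le [IsProbabilityMeasure P] {W : Ω → EuclideanSpace ℝ (Fin d)}
    (hW : Measurable W) {t p : ℝ} (hp : 0 ≤ p) {x : EuclideanSpace ℝ (Fin d)}
    (h : P {ω | t ≤ inner ℝ (W ω) x} ≤ ENNReal.ofReal p) :
    ∫⁻ ω, ENNReal.ofReal (Real.exp (exceeds t (W ω) x)) ∂P ≤
      ENNReal.ofReal (Real.exp (2 * p)) := by
  have hm : MeasurableSet {ω | t ≤ inner ℝ (W ω) x} :=
    measurableSet_le measurable_const (by fun_prop)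
  calc ∫⁻ ω, ENNReal.ofReal (Real.exp (exceeds t (W ω) x)) ∂P
      ≤ ∫⁻ ω, (1 + Set.indicator {ω | t ≤ inner ℝ (W ω) x} (fun _ => 2) ω) ∂P := by
        refine lintegral_mono fun ω => ?_
        by_cases hω : t ≤ inner ℝ (W ω) x
        · have h3 : ENNReal.ofReal (Real.exp 1) ≤ 1 + 2 := by
            rw [show (1 + 2 : ENNReal) = ENNReal.ofReal 3 by norm_num]
            exact ENNReal.ofReal_le_ofReal Real.exp_one_lt_three.le
          simpa [exceeds, hω] using h3
        · simp [exceeds, hω]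
    _ = 1 + 2 * P {ω | t ≤ inner ℝ (W ω) x} := by
        rw [lintegral_add_left measurable_const, lintegral_indicator_const hm]
        simp
    _ ≤ 1 + 2 * ENNReal.ofReal p := by gcongr
    _ = ENNReal.ofReal (1 + 2 * p) := by
        rw [ENNReal.ofReal_add one_pos.le (by positivity), ENNReal.ofReal_mul two_pos.le]
        simp
    _ ≤ _ := ENNReal.ofReal_le_ofReal (by linarith [Real.add_one_le_exp (2 * p)])

/-- The PAC-Bayes bound. For independent random vectors `W j` whose projection on each `x` exceeds
`t` with probability at most `q x`, with probability at least `1 - δ` the number of `j` with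
`t ≤ inner ℝ (W j) u` is controlled simultaneously for all `u` by a Gaussian average of `q`
around `u`. -/
theorem exists_event_sum_exceeds_le [IsProbabilityMeasure P]
    {W : Fin k → Ω → EuclideanSpace ℝ (Fin d)} (hWm : ∀ j, Measurable (W j))
    (hindep : iIndepFun W P) {q : EuclideanSpace ℝ (Fin d) → ℝ} (hq : Measurable q)
    (hq0 : ∀ x, 0 ≤ q x) {t : ℝ}
    (hP : ∀ j x, P {ω | t ≤ inner ℝ (W j ω) x} ≤ ENNReal.ofReal (q x)) {δ : ℝ} (hδ : 0 < δ) :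
    ∃ A : Set Ω, MeasurableSet A ∧ ENNReal.ofReal (1 - δ) ≤ P A ∧
      ∀ ω ∈ A, ∀ u : EuclideanSpace ℝ (Fin d),
        Integrable (fun x => q (x + u)) (stdGaussian (EuclideanSpace ℝ (Fin d))) →
        (∑ j, exceeds t (W j ω) u) / 2 ≤
          2 * k * (∫ x, q (x + u) ∂stdGaussian (EuclideanSpace ℝ (Fin d))) +
            Real.log (1 / δ) + ‖u‖ ^ 2 / 2 := by
  set γ := stdGaussian (EuclideanSpace ℝ (Fin d)) with hγ
  let F : Ω → EuclideanSpace ℝ (Fin d) → ℝ := fun ω x =>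
    ∑ j, exceeds t (W j ω) x - 2 * k * q x
  have hF : Measurable fun p : Ω × EuclideanSpace ℝ (Fin d) => F p.1 p.2 := by
    have h (j : Fin k) : Measurable fun p : Ω × EuclideanSpace ℝ (Fin d) =>
      exceeds t (W j p.1) p.2 := ((hWm j).comp measurable_fst).exceeds measurable_snd t
    exact (Finset.measurable_sum _ fun j _ => h j).sub ((hq.comp measurable_snd).const_mul _)
  have hFe : Measurable fun p : Ω × EuclideanSpace ℝ (Fin d) =>
      ENNReal.ofReal (Real.exp (F p.1 p.2)) := by fun_prop
  have hmoment (x : EuclideanSpace ℝ (Fin d)) :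
      ∫⁻ ω, ENNReal.ofReal (Real.exp (F ω x)) ∂P ≤ 1 := by
    have hfac (ω : Ω) : ENNReal.ofReal (Real.exp (F ω x)) =
        (∏ j, ENNReal.ofReal (Real.exp (exceeds t (W j ω) x))) *
          ENNReal.ofReal (Real.exp (-(2 * k * q x))) := by
      rw [← ENNReal.ofReal_prod_of_nonneg fun j _ => (Real.exp_pos _).le, ← Real.exp_sum,
        ← ENNReal.ofReal_mul (Real.exp_pos _).le, ← Real.exp_add, ← sub_eq_add_neg]
    have hm (j : Fin k) : Measurable fun ω => ENNReal.ofReal (Real.exp (exceeds t (W j ω) x)) := by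
      have := hWm j
      fun_prop
    have hind : iIndepFun (fun j ω => ENNReal.ofReal (Real.exp (exceeds t (W j ω) x))) P :=
      hindep.comp (fun _ w => ENNReal.ofReal (Real.exp (exceeds t w x))) fun _ => by fun_prop
    simp_rw [hfac]
    rw [lintegral_mul_const _ (Finset.measurable_prod _ fun j _ => hm j),
      lintegral_prod_eq_prod_lintegral_of_indepFun _ _ hind hm]
    calc _ ≤ (∏ _j : Fin k, ENNReal.ofReal (Real.exp (2 * q x))) *
          ENNReal.ofReal (Real.exp (-(2 * k * q x))) := by
          gcongr with j
          exact lintegral_exp_exceeds_le (hWm j) (hq0 x) (hP j x)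
      _ = 1 := by
          rw [Finset.prod_const, ← ENNReal.ofReal_pow (Real.exp_pos _).le, ← Real.exp_nat_mul,
            ← ENNReal.ofReal_mul (Real.exp_pos _).le, ← Real.exp_add]
          simp
          ring_nf
  have hH : Measurable fun ω => ∫⁻ x, ENNReal.ofReal (Real.exp (F ω x)) ∂γ :=
    hFe.lintegral_prod_right'
  have htotal : ∫⁻ ω, ∫⁻ x, ENNReal.ofReal (Real.exp (F ω x)) ∂γ ∂P ≤ 1 := by
    rw [lintegral_lintegral_swap hFe.aemeasurable]
    exact (lintegral_mono hmoment).trans_eq (by simp)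
  set A := {ω | ∫⁻ x, ENNReal.ofReal (Real.exp (F ω x)) ∂γ ≤ ENNReal.ofReal (1 / δ)} with hA
  have hAm : MeasurableSet A := measurableSet_le hH measurable_const
  refine ⟨A, hAm, ?_, fun ω hω u hint => ?_⟩
  · have hc : P Aᶜ ≤ ENNReal.ofReal δ := by
      calc P Aᶜ ≤ P {ω | ENNReal.ofReal (1 / δ) ≤
            ∫⁻ x, ENNReal.ofReal (Real.exp (F ω x)) ∂γ} :=
            measure_mono fun ω hω => by
              rw [Set.mem_compl_iff, hA, Set.mem_ofPred_eq, not_le] at hω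
              exact hω.le
        _ ≤ (∫⁻ ω, ∫⁻ x, ENNReal.ofReal (Real.exp (F ω x)) ∂γ ∂P) / ENNReal.ofReal (1 / δ) :=
            meas_ge_le_lintegral_div hH.aemeasurable (by simpa using hδ) ENNReal.ofReal_ne_top
        _ ≤ 1 / ENNReal.ofReal (1 / δ) := by gcongr
        _ = ENNReal.ofReal δ := by
            rw [one_div δ, ENNReal.ofReal_inv_of_pos hδ, one_div, inv_inv]
    have h1 : (1 : ENNReal) ≤ P A + ENNReal.ofReal δ := by
      rw [← prob_add_prob_compl (μ := P) hAm]
      gcongr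
    rw [ENNReal.ofReal_sub _ hδ.le, ENNReal.ofReal_one]
    exact tsub_le_iff_right.2 h1
  · have hex (j : Fin k) := integrable_exceeds_add_stdGaussian t (W j ω) u
    have hsum : Integrable (fun x => ∑ j, exceeds t (W j ω) (x + u)) γ :=
      integrable_finsetSum _ fun j _ => hex j
    have hq' : Integrable (fun x => 2 * k * q (x + u)) γ := hint.const_mul _
    have hFω : Measurable (F ω) := hF.of_uncurry_left
    have hFi : Integrable (fun x => F ω (x + u)) γ := by
      simp only [F]
      exact hsum.sub hq'
    have hDV := integral_add_stdGaussian_le hFω (one_div_pos.2 hδ) hω u hFi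
    simp only [F] at hDV
    rw [integral_sub hsum hq', integral_const_mul, integral_finsetSum _ fun j _ => hex j] at hDV
    have hhalf : (∑ j, exceeds t (W j ω) u) / 2 ≤
        ∑ j, ∫ x, exceeds t (W j ω) (x + u) ∂γ := by
      rw [Finset.sum_div]
      exact Finset.sum_le_sum fun j _ => exceeds_div_two_le_integral t (W j ω) u
    linarith

end Count

/-! ### The median-of-means tournament -/

section Tournament

variable {Ω : Type*} [MeasurableSpace Ω] {P : Measure Ω} {d N k : ℕ}

/-- A block that does not prefer `μ` to `a` has a large projection on the direction `a - μ`. -/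
theorem le_inner_of_norm_sub_le {z μ a : EuclideanSpace ℝ (Fin d)} (ha : a ≠ μ) {r ρ : ℝ}
    (hρ : 0 ≤ ρ) (hr : r ≤ ‖a - μ‖) (h : ‖z - a‖ ≤ ‖z - μ‖) :
    ρ * r / 2 ≤ inner ℝ (z - μ) ((ρ / ‖a - μ‖) • (a - μ)) := by
  have hv : 0 < ‖a - μ‖ := norm_pos_iff.2 (sub_ne_zero.2 ha)
  have hsq : ‖z - a‖ ^ 2 ≤ ‖z - μ‖ ^ 2 := by gcongr
  rw [← sub_sub_sub_cancel_right z a μ, norm_sub_sq_real] at hsq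
  rw [inner_smul_right]
  calc ρ * r / 2 ≤ ρ * ‖a - μ‖ / 2 := by gcongr
    _ = ρ / ‖a - μ‖ * (‖a - μ‖ ^ 2 / 2) := by field_simp
    _ ≤ _ := by
      gcongr
      linarith

theorem lt_ncard_of_sum_exceeds_lt {Z : Fin k → EuclideanSpace ℝ (Fin d)}
    {μ a : EuclideanSpace ℝ (Fin d)} (ha : a ≠ μ) {r ρ : ℝ} (hρ : 0 ≤ ρ) (hr : r ≤ ‖a - μ‖)
    (h : ∑ j, exceeds (ρ * r / 2) (Z j - μ) ((ρ / ‖a - μ‖) • (a - μ)) < k / 2) :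
    (k : ℝ) / 2 < ({j : Fin k | ‖Z j - μ‖ < ‖Z j - a‖}.ncard : ℝ) := by
  classical
  set G : Finset (Fin k) := {j | ‖Z j - μ‖ < ‖Z j - a‖} with hG
  have hcard : {j : Fin k | ‖Z j - μ‖ < ‖Z j - a‖}.ncard = G.card := by
    rw [← Set.ncard_coe_finset]
    simp [hG]
  have hcompl : (G.card : ℝ) + (Gᶜ.card : ℝ) = k := by
    exact_mod_cast (G.card_add_card_compl).trans (Fintype.card_fin k)
  have hle : (Gᶜ.card : ℝ) ≤
      ∑ j, exceeds (ρ * r / 2) (Z j - μ) ((ρ / ‖a - μ‖) • (a - μ)) := by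
    calc (Gᶜ.card : ℝ)
        = ∑ j ∈ Gᶜ, exceeds (ρ * r / 2) (Z j - μ) ((ρ / ‖a - μ‖) • (a - μ)) := by
          rw [Finset.card_eq_sum_ones, Nat.cast_sum]
          refine Finset.sum_congr rfl fun j hj => ?_
          have hj' : ‖Z j - a‖ ≤ ‖Z j - μ‖ := by simpa [hG] using hj
          rw [exceeds, if_pos (le_inner_of_norm_sub_le ha hρ hr hj'), Nat.cast_one]
      _ ≤ _ := Finset.sum_le_sum_of_subset_of_nonneg (Finset.subset_univ _)
          fun j _ _ => exceeds_nonneg _ _ _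
  rw [hcard]
  linarith

/-- Rounding `N / k` down loses at most a factor of two in the block size. -/
theorem IsBlockPartition.inv_card_le {B : Fin k → Finset (Fin N)} (hB : IsBlockPartition B)
    (hkN : k ≤ N) (j : Fin k) : (B j).Nonempty ∧ ((B j).card : ℝ)⁻¹ ≤ 2 * k / N := by
  have hk : 0 < k := j.pos
  have hq : 1 ≤ N / k := (Nat.one_le_div_iff hk).2 hkN
  have hc : 1 ≤ (B j).card := hq.trans (hB.card_ge j)
  refine ⟨Finset.card_pos.1 hc, ?_⟩
  have hN : N ≤ 2 * k * (B j).card := by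
    calc N ≤ k * (N / k + 1) := (Nat.lt_mul_div_succ N hk).le
      _ ≤ k * (2 * (B j).card) := by
        have := hB.card_ge j
        gcongr
        omega
      _ = _ := by ring
  have hN' : (N : ℝ) ≤ 2 * k * (B j).card := by exact_mod_cast hN
  have hN0 : (0 : ℝ) < N := by exact_mod_cast hk.trans_le hkN
  rw [inv_le_comm₀ (by positivity) (by positivity), inv_div, div_le_iff₀ (by positivity)]
  linarith

/-- The two terms of the radius, with the square roots cleared. -/
theorem le_mul_radius_sq (S : Matrix (Fin d) (Fin d) ℝ) (hN : 0 < N) (δ : ℝ) :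
    160000 * S.trace ≤ N * radius S N δ ^ 2 ∧
      57600 * (lambdaMax S * Real.log (2 / δ)) ≤ N * radius S N δ ^ 2 := by
  have hr : 0 ≤ radius S N δ := le_max_of_le_left (by positivity)
  have hN' : (0 : ℝ) < N := by exact_mod_cast hN
  have key {c y : ℝ} (hc : 0 < c) (h : c * √(y / N) ≤ radius S N δ) :
      c ^ 2 * y ≤ N * radius S N δ ^ 2 := by
    have h1 : √(y / N) ≤ radius S N δ / c := by rwa [le_div_iff₀' hc]
    rw [Real.sqrt_le_left (by positivity), div_pow, div_le_div_iff₀ hN' (by positivity)] at h1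
    linarith
  refine ⟨?_, ?_⟩
  · convert! key (c := 400) (by norm_num) (le_max_left _ _) using 2
    norm_num
  · convert! key (c := 240) (by norm_num) (le_max_right _ _) using 2
    norm_num

/-- The choice of constants: with smoothing scale `ρ ^ 2 = k / 50` the PAC-Bayes bound is less
than `k / 4`. The two terms of the radius pay for the trace and for the largest eigenvalue. -/
theorem pacBayes_bound_lt {k N L l r T Q v : ℝ} (hk : 0 < k) (hN : 0 < N) (hr : 0 < r)
    (hkL : 360 * L ≤ k) (hkL' : k ≤ 362 * L) (hl : 0 ≤ l) (hT : 160000 * T ≤ N * r ^ 2)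
    (hlr : 57600 * (l * L) ≤ N * r ^ 2) (hQ : Q ≤ l * (k / 50)) (hv : v ≤ L) :
    2 * k * ((Q + T) * (2 * k / N / (k / 50 * r ^ 2 / 4))) + v + k / 50 / 2 < k / 4 := by
  have hNr : 0 < N * r ^ 2 := by positivity
  have hkl : l * k ≤ 362 * (l * L) := by nlinarith
  have h1 : (Q + T) / (N * r ^ 2) ≤ 362 / 57600 / 50 + 1 / 160000 := by
    rw [div_le_iff₀ hNr]
    linarith
  have h2 : 2 * k * ((Q + T) * (2 * k / N / (k / 50 * r ^ 2 / 4))) =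
      800 * k * ((Q + T) / (N * r ^ 2)) := by
    field_simp
    ring
  rw [h2]
  have h3 := mul_le_mul_of_nonneg_left h1 (by positivity : 0 ≤ 800 * k)
  linarith

/-- The tournament bound for everywhere measurable random vectors, whose laws need only share
their first two moments. -/
theorem exists_event_tournament [IsProbabilityMeasure P] {δ : ℝ} (hδ0 : 0 < δ) (hδ1 : δ < 1)
    (hk : k = ⌈360 * Real.log (2 / δ)⌉₊) (hkN : k ≤ N)
    {X : Fin N → Ω → EuclideanSpace ℝ (Fin d)} (hXm : ∀ i, Measurable (X i))
    (hindep : iIndepFun X P) (hL2 : ∀ i, MemLp (X i) 2 P)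
    {μ : EuclideanSpace ℝ (Fin d)} (hmean : ∀ i, ∫ ω, X i ω ∂P = μ)
    {S : Matrix (Fin d) (Fin d) ℝ} (hcov : ∀ i, covarianceMatrix (X i) P = S)
    {B : Fin k → Finset (Fin N)} (hB : IsBlockPartition B) :
    ∃ A : Set Ω, MeasurableSet A ∧ ENNReal.ofReal (1 - δ) ≤ P A ∧
      ∀ ω ∈ A, ∀ a : EuclideanSpace ℝ (Fin d), a ≠ μ → radius S N δ ≤ ‖a - μ‖ →
        (k : ℝ) / 2 <
          ({j : Fin k | ‖blockMean X (B j) ω - μ‖ < ‖blockMean X (B j) ω - a‖}.ncard : ℝ) := by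
  set L := Real.log (2 / δ) with hL
  have hlog : Real.log (1 / δ) ≤ L := Real.log_le_log (by positivity) (by gcongr; norm_num)
  have hL1 : 1 / 2 < L := by
    have h2 : Real.log 2 ≤ L := by
      refine Real.log_le_log two_pos ?_
      rw [le_div_iff₀ hδ0]
      linarith
    linarith [Real.log_two_gt_d9]
  have hkL : 360 * L ≤ k := hk ▸ Nat.le_ceil _
  have hkL' : (k : ℝ) ≤ 362 * L := by
    have : (k : ℝ) < 360 * L + 1 := hk ▸ Nat.ceil_lt_add_one (by positivity)
    linarith
  have hk0 : (0 : ℝ) < k := by linarith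
  have hk0' : 0 < k := by exact_mod_cast hk0
  have hN : 0 < N := hk0'.trans_le hkN
  have hN0 : (0 : ℝ) < N := by exact_mod_cast hN
  let i₀ : Fin N := ⟨0, hN⟩
  have hQ0 (x : EuclideanSpace ℝ (Fin d)) : 0 ≤ quadForm S x :=
    hcov i₀ ▸ quadForm_covarianceMatrix_nonneg (hL2 i₀) x
  have hherm : S.IsHermitian := hcov i₀ ▸ isHermitian_covarianceMatrix (X i₀)
  have hr0 : 0 ≤ radius S N δ := le_max_of_le_left (by positivity)
  rcases hr0.eq_or_lt with hr | hr
  · -- If the radius vanishes, so does the trace, and all the block means equal `μ` almost surely.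
    have htr : S.trace = 0 := by
      have h0 : 0 ≤ S.trace := hcov i₀ ▸ trace_covarianceMatrix_nonneg (hL2 i₀)
      have h1 : 400 * √(S.trace / N) ≤ 0 := hr ▸ le_max_left _ _
      have h2 : √(S.trace / N) = 0 := le_antisymm (by linarith) (Real.sqrt_nonneg _)
      rw [Real.sqrt_eq_zero (by positivity), div_eq_zero_iff] at h2
      exact h2.resolve_right hN0.ne'
    have hae : ∀ᵐ ω ∂P, ∀ i, X i ω = μ := ae_all_iff.2 fun i => by
      rw [← hmean i]
      exact ae_eq_integral_of_trace_covarianceMatrix_eq_zero (hL2 i) (by rw [hcov i, htr])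
    have hAm : MeasurableSet {ω | ∀ i, X i ω = μ} := by
      rw [Set.ofPred_forall]
      exact MeasurableSet.iInter fun i => hXm i (measurableSet_singleton μ)
    refine ⟨{ω | ∀ i, X i ω = μ}, hAm, ?_, fun ω hω a ha _ => ?_⟩
    · rw [show P {ω | ∀ i, X i ω = μ} = 1 from (prob_compl_eq_zero_iff hAm).1 hae]
      exact ENNReal.ofReal_le_one.2 (by linarith)
    · have hZ (j : Fin k) : blockMean X (B j) ω = μ := by
        have hc : ((B j).card : ℝ) ≠ 0 := by
          simpa using (hB.inv_card_le hkN j).1.ne_empty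
        rw [blockMean, Finset.sum_congr rfl fun i _ => hω i, Finset.sum_const,
          ← Nat.cast_smul_eq_nsmul ℝ, smul_smul, inv_mul_cancel₀ hc, one_smul]
      have huniv : {j : Fin k | ‖blockMean X (B j) ω - μ‖ < ‖blockMean X (B j) ω - a‖} =
          Set.univ := by
        ext j
        simp [hZ j, sub_eq_zero, ha.symm]
      rw [huniv, Set.ncard_univ, Nat.card_eq_fintype_card, Fintype.card_fin]
      linarith
  · set r := radius S N δ with hrdef
    set ρ := √((k : ℝ) / 50) with hρ
    have hρ2 : ρ ^ 2 = k / 50 := Real.sq_sqrt (by positivity)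
    have hρ0 : 0 < ρ := Real.sqrt_pos.2 (by positivity)
    have ht2 : (ρ * r / 2) ^ 2 = k / 50 * r ^ 2 / 4 := by
      rw [div_pow, mul_pow, hρ2]
      norm_num
    let c : ℝ := 2 * k / N / (k / 50 * r ^ 2 / 4)
    have hc0 : 0 ≤ c := by positivity
    obtain ⟨A, hAm, hAP, hA⟩ := exists_event_sum_exceeds_le (P := P)
      (W := fun j ω => blockMean X (B j) ω - μ) (q := fun x => quadForm S x * c)
      (t := ρ * r / 2)
      (fun j => (measurable_blockMean hXm (B j)).sub_const μ)
      ((iIndepFun_blockMean hindep hXm hB.disjoint).comp (fun _ z => z - μ)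
        fun _ => by fun_prop)
      (by fun_prop) (fun x => mul_nonneg (hQ0 x) hc0)
      (fun j x => by
        obtain ⟨hne, hcard⟩ := hB.inv_card_le hkN j
        refine (measure_le_inner_blockMean_sub_le hindep hL2 hmean hcov hne x
          (by positivity)).trans (ENNReal.ofReal_le_ofReal ?_)
        rw [ht2, div_eq_mul_inv (quadForm S x), mul_div_assoc]
        have := hQ0 x
        simp only [c]
        gcongr) hδ0
    refine ⟨A, hAm, hAP, fun ω hω a ha har => ?_⟩
    refine lt_ncard_of_sum_exceeds_lt ha hρ0.le har ?_
    set u := (ρ / ‖a - μ‖) • (a - μ) with hu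
    have hunorm : ‖u‖ ^ 2 = k / 50 := by
      have hv : 0 < ‖a - μ‖ := norm_pos_iff.2 (sub_ne_zero.2 ha)
      rw [hu, norm_smul, Real.norm_of_nonneg (by positivity), div_mul_cancel₀ _ hv.ne', hρ2]
    obtain ⟨hint, hval⟩ := integrable_and_integral_quadForm_add_stdGaussian S u
    have h := hA ω hω u (hint.mul_const c)
    rw [integral_mul_const, hval, hunorm] at h
    have hQu : quadForm S u ≤ lambdaMax S * (k / 50) := hunorm ▸ quadForm_le_lambdaMax hherm u
    have hl : 0 ≤ lambdaMax S :=
      nonneg_of_mul_nonneg_left ((hQ0 u).trans hQu) (by positivity)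
    obtain ⟨hT, hlr⟩ := le_mul_radius_sq S hN δ
    have := pacBayes_bound_lt hk0 hN0 hr hkL hkL' hl hT hlr hQu hlog
    simp only [c] at h
    linarith

end Tournament

theorem theorem2 {Ω : Type*} [MeasurableSpace Ω] (P : Measure Ω) [IsProbabilityMeasure P]
    (d N k : ℕ) (δ : ℝ) (hδ0 : 0 < δ) (hδ1 : δ < 1)
    (hk : k = ⌈360 * Real.log (2 / δ)⌉₊) (hkN : k ≤ N)
    (X : Fin N → Ω → EuclideanSpace ℝ (Fin d))
    (hindep : iIndepFun X P)
    (hident : ∀ i j, IdentDistrib (X i) (X j) P P)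
    (hL2 : ∀ i, MemLp (X i) 2 P)
    (μ : EuclideanSpace ℝ (Fin d)) (hmean : ∀ i, ∫ ω, X i ω ∂P = μ)
    (S : Matrix (Fin d) (Fin d) ℝ) (hcov : ∀ i, covarianceMatrix (X i) P = S)
    (B : Fin k → Finset (Fin N)) (hB : IsBlockPartition B) :
    ∃ A : Set Ω, MeasurableSet A ∧ ENNReal.ofReal (1 - δ) ≤ P A ∧
      ∀ ω ∈ A, ∀ a : EuclideanSpace ℝ (Fin d), a ≠ μ → radius S N δ ≤ ‖a - μ‖ →
        (k : ℝ) / 2 <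
          ({j : Fin k | ‖blockMean X (B j) ω - μ‖ < ‖blockMean X (B j) ω - a‖}.ncard : ℝ) := by

  -- Replace each `X i` by a measurable modification.
  let Y : Fin N → Ω → EuclideanSpace ℝ (Fin d) := fun i => (hL2 i).1.mk (X i)
  have hXY (i : Fin N) : X i =ᵐ[P] Y i := (hL2 i).1.ae_eq_mk
  have hYcov (i : Fin N) : covarianceMatrix (Y i) P = S := by
    have hint (a : Fin d) : ∫ ω, Y i ω a ∂P = ∫ ω, X i ω a ∂P :=
      integral_congr_ae ((hXY i).mono fun ω hω => by simp only [hω])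
    rw [← hcov i]
    ext a b
    simp only [covarianceMatrix, Matrix.of_apply, covariance, hint]
    exact integral_congr_ae ((hXY i).mono fun ω hω => by simp only [hω])
  obtain ⟨A, hAm, hAP, hA⟩ := exists_event_tournament (P := P) hδ0 hδ1 hk hkN
    (X := Y) (fun i => (hL2 i).1.stronglyMeasurable_mk.measurable) (hindep.congr hXY)
    (fun i => (memLp_congr_ae (hXY i)).1 (hL2 i))
    (fun i => (integral_congr_ae (hXY i)).symm.trans (hmean i)) hYcov hB
  have hnull : P {ω | ¬∀ i, X i ω = Y i ω} = 0 := ae_all_iff.2 hXY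
  obtain ⟨s, hs, hsm, hs0⟩ := exists_measurable_superset_of_null hnull
  refine ⟨A \ s, hAm.diff hsm, hAP.trans_eq (measure_sdiff_null hs0).symm, fun ω hω a ha har => ?_⟩
  have hω' : ∀ i, X i ω = Y i ω := by
    by_contra h
    exact hω.2 (hs h)
  have hZ (j : Fin k) : blockMean X (B j) ω = blockMean Y (B j) ω := by
    simp only [blockMean, hω']
  simp only [hZ]
  exact hA ω hω.1 a ha har
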